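/- A directed graph $E=(E^0,E^1,r,s)$ consists of arbitrary sets $E^0$ (vertices) and $E^1$ (edges) and maps $r,s:E^1\to E^0$ (range and source). A path is a vertex (length zero) or a sequence $\mu=e_1\cdots e_n$ of edges with $r(e_i)=s(e_{i+1})$; it is a cycle if $n\ge 1$, $r(e_n)=s(e_1)$ and $s(e_i)\ne s(e_j)$ for $i\ne j$. An exit for $\mu$ is an edge $f$ such that $s(f)=s(e_i)$ and $f\neq e_i$ for some $i$. The graph $E$ satisfies Condition (L) if every cycle in $E$ has an exit. For a commutative ring $R$ with unit, the Leavitt path algebra $L_R(E)$ is the universal (not necessarily unital) associative $R$-algebra generated by pairwise orthogonal idempotents $v$ ($v\in E^0$) and elements $e,e^*$ ($e\in E^1$) such that (1) $s(e)e=e=e\,r(e)$; (2) $r(e)e^*=e^*=e^*s(e)$; (3) $e^*e=r(e)$, and $e^*f=0$ if $e\ne f$; (4) $v=\sum_{s(e)=v}ee^*$ for every vertex $v$ such that $s^{-1}(v)$ is finite and non-empty. It carries the $R$-linear involution $*$ (an anti-automorphism) that fixes every vertex and exchanges $e$ and $e^*$. The commutative core $M_R(E)$ is the (not necessarily unital)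 $R$-subalgebra of $L_R(E)$ generated by those elements $x=\alpha\beta^*$, with $\alpha,\beta$ paths such that $r(\alpha)=r(\beta)$, that are normal, i.e. satisfy $xx^*=x^*x$. **Corollary.** Let $E$ be a directed graph satisfying Condition (L), let $R$ be a commutative ring with unit, let $\mathcal A$ be a (not necessarily unital) associative ring, and let $\Phi:L_R(E)\to\mathcal A$ be a ring homomorphism, i.e. an additive and multiplicative map. Then the following conditions are equivalent: (i) $\Phi$ is injective; (ii) the restriction of $\Phi$ to $M_R(E)$ is injective; (iii) $\Phi(rv)\neq 0$ for all $v\in E^0$ and all $r\in R\setminus\{0\}$. -/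

import Mathlib

universe u v w x

/-- A directed graph `(E⁰, E¹, r, s)`: arbitrary sets of vertices and edges, with range and source
maps. -/
structure DirectedGraph where
  /-- the vertices -/
  Vertex : Type u
  /-- the edges -/
  Edge : Type v
  /-- the source of an edge -/
  source : Edge → Vertex
  /-- the range of an edge -/
  range : Edge → Vertex

namespace DirectedGraph

variable (E : DirectedGraph.{u, v})

/-- `E.IsPath a l b`: the list of edges `l` is a path from `a` to `b`, that is, consecutive edges
satisfy `r(eᵢ) = s(eᵢ₊₁)`, the first edge starts at `a` and the last one ends at `b`. The empty list
is the path of length zero at the vertex `a = b`. -/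
def IsPath : E.Vertex → List E.Edge → E.Vertex → Prop
  | a, [], b => a = b
  | a, e :: l, b => E.source e = a ∧ IsPath (E.range e) l b

/-- A cycle based at `a`: a closed path of positive length whose edges have pairwise distinct
sources. -/
def IsCycle (a : E.Vertex) (l : List E.Edge) : Prop :=
  E.IsPath a l a ∧ l ≠ [] ∧ (l.map E.source).Nodup

/-- An exit for the path `l = e₁ ⋯ eₙ`: an edge `f` such that, for some `i`, `s(f) = s(eᵢ)` and
`f ≠ eᵢ`. -/
def IsExit (l : List E.Edge) (f : E.Edge) : Prop :=
  ∃ e ∈ l, E.source f = E.source e ∧ f ≠ e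

/-- Condition (L): every cycle has an exit. -/
def ConditionL : Prop :=
  ∀ (a : E.Vertex) (l : List E.Edge), E.IsCycle a l → ∃ f, E.IsExit l f

/-- The generators of the Leavitt path algebra: vertices `v`, edges `e`, ghost edges `e*`. -/
inductive LeavittGen : Type (max u v)
  | vertex (a : E.Vertex) : LeavittGen
  | edge (e : E.Edge) : LeavittGen
  | ghost (e : E.Edge) : LeavittGen

end DirectedGraph

/-- The free associative (not necessarily unital) `R`-algebra on the set `X`: formal `R`-linear
combinations of nonempty words in `X`. -/
abbrev FreeAssocAlgebra (R : Type w) [CommRing R] (X : Type u) : Type (max u w) :=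
  MonoidAlgebra R (FreeSemigroup X)

/-- A letter, as an element of the free algebra. -/
noncomputable def FreeAssocAlgebra.of (R : Type w) [CommRing R] {X : Type u} (a : X) :
    FreeAssocAlgebra R X :=
  MonoidAlgebra.ofMagma R (FreeSemigroup X) (FreeSemigroup.of a)

section Leavitt

variable (R : Type w) [CommRing R] (E : DirectedGraph.{u, v})

open DirectedGraph FreeAssocAlgebra

/-- The defining relations of the Leavitt path algebra, together with their `R`-multiples. In `ck2`
the hypotheses say that the vertex `a` is regular and that `S` is the finite nonempty set
`s⁻¹(a)`. -/
inductive LeavittRel : FreeAssocAlgebra R E.LeavittGen → FreeAssocAlgebra R E.LeavittGen → Prop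
  | idem (a : E.Vertex) : LeavittRel (of R (.vertex a) * of R (.vertex a)) (of R (.vertex a))
  | orth (a b : E.Vertex) (h : a ≠ b) : LeavittRel (of R (.vertex a) * of R (.vertex b)) 0
  | source_edge (e : E.Edge) :
      LeavittRel (of R (.vertex (E.source e)) * of R (.edge e)) (of R (.edge e))
  | edge_range (e : E.Edge) :
      LeavittRel (of R (.edge e) * of R (.vertex (E.range e))) (of R (.edge e))
  | range_ghost (e : E.Edge) :
      LeavittRel (of R (.vertex (E.range e)) * of R (.ghost e)) (of R (.ghost e))
  | ghost_source (e : E.Edge) :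
      LeavittRel (of R (.ghost e) * of R (.vertex (E.source e))) (of R (.ghost e))
  | ck1_same (e : E.Edge) :
      LeavittRel (of R (.ghost e) * of R (.edge e)) (of R (.vertex (E.range e)))
  | ck1_ne (e f : E.Edge) (h : e ≠ f) : LeavittRel (of R (.ghost e) * of R (.edge f)) 0
  | ck2 (a : E.Vertex) (S : Finset E.Edge) (hS : ∀ e, e ∈ S ↔ E.source e = a) (hne : S.Nonempty) :
      LeavittRel (of R (.vertex a)) (∑ e ∈ S, of R (.edge e) * of R (.ghost e))
  | smul (r : R) {p q : FreeAssocAlgebra R E.LeavittGen} (h : LeavittRel p q) :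
      LeavittRel (r • p) (r • q)

/-- The ring congruence generated by the defining relations. -/
noncomputable def leavittCon : RingCon (FreeAssocAlgebra R E.LeavittGen) :=
  ringConGen (LeavittRel R E)

theorem leavittCon_smul (r : R) {p q : FreeAssocAlgebra R E.LeavittGen}
    (h : leavittCon R E p q) : leavittCon R E (r • p) (r • q) := by
  induction h with
  | of p q h => exact RingConGen.Rel.of _ _ (.smul r h)
  | refl p => exact RingConGen.Rel.refl _
  | symm _ ih => exact RingConGen.Rel.symm ih
  | trans _ _ ih₁ ih₂ => exact RingConGen.Rel.trans ih₁ ih₂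
  | add _ _ ih₁ ih₂ =>
    rw [smul_add, smul_add]
    exact RingConGen.Rel.add ih₁ ih₂
  | mul _ h₂ ih₁ _ =>
    rw [← smul_mul_assoc, ← smul_mul_assoc]
    exact RingConGen.Rel.mul ih₁ h₂

/-- The Leavitt path algebra `L_R(E)`: the universal (not necessarily unital) associative
`R`-algebra on the vertices, edges and ghost edges subject to the Leavitt relations. -/
def LeavittPathAlgebra : Type (max u v w) :=
  (leavittCon R E).Quotient

namespace LeavittPathAlgebra

noncomputable instance : NonUnitalRing (LeavittPathAlgebra R E) :=
  inferInstanceAs (NonUnitalRing (leavittCon R E).Quotient)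

/-- The class of an element of the free algebra. -/
noncomputable def mk (p : FreeAssocAlgebra R E.LeavittGen) : LeavittPathAlgebra R E :=
  (p : (leavittCon R E).Quotient)

theorem mk_surjective : Function.Surjective (mk R E) :=
  Quotient.mk''_surjective

/-- `mk` as an additive homomorphism. -/
noncomputable def mkAddHom : FreeAssocAlgebra R E.LeavittGen →+ LeavittPathAlgebra R E where
  toFun := mk R E
  map_zero' := rfl
  map_add' _ _ := rfl

noncomputable instance : SMul R (LeavittPathAlgebra R E) where
  smul r := Quotient.map' (fun p => r • p) fun _ _ h => leavittCon_smul R E r h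

noncomputable instance : Module R (LeavittPathAlgebra R E) :=
  Function.Surjective.module R (mkAddHom R E) (mk_surjective R E) fun _ _ => rfl

instance : IsScalarTower R (LeavittPathAlgebra R E) (LeavittPathAlgebra R E) where
  smul_assoc r a b := by
    obtain ⟨p, rfl⟩ := mk_surjective R E a
    obtain ⟨q, rfl⟩ := mk_surjective R E b
    exact congrArg (mk R E) (smul_mul_assoc r p q)

instance : SMulCommClass R (LeavittPathAlgebra R E) (LeavittPathAlgebra R E) where
  smul_comm r a b := by
    obtain ⟨p, rfl⟩ := mk_surjective R E a
    obtain ⟨q, rfl⟩ := mk_surjective R E b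
    exact congrArg (mk R E) (mul_smul_comm r p q).symm

/-- The quotient map from the free algebra. -/
noncomputable def mkHom : FreeAssocAlgebra R E.LeavittGen →ₙₐ[R] LeavittPathAlgebra R E where
  toFun := mk R E
  map_smul' _ _ := rfl
  map_zero' := rfl
  map_add' _ _ := rfl
  map_mul' _ _ := rfl

variable {E}

/-- A generator, as an element of `L_R(E)`. -/
noncomputable def gen (a : E.LeavittGen) : LeavittPathAlgebra R E := mkHom R E (of R a)

/-- The vertex `a` as an element of `L_R(E)`. -/
noncomputable def vertex (a : E.Vertex) : LeavittPathAlgebra R E := gen R (.vertex a)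

/-- The edge `e` as an element of `L_R(E)`. -/
noncomputable def edge (e : E.Edge) : LeavittPathAlgebra R E := gen R (.edge e)

/-- The ghost edge `e*` as an element of `L_R(E)`. -/
noncomputable def ghost (e : E.Edge) : LeavittPathAlgebra R E := gen R (.ghost e)

variable (E)

variable {R}

theorem mkHom_eq_of_rel {p q : FreeAssocAlgebra R E.LeavittGen} (h : LeavittRel R E p q) :
    mkHom R E p = mkHom R E q :=
  Quotient.sound' (RingConGen.Rel.of _ _ h)

variable {E}

theorem vertex_idem (a : E.Vertex) : vertex R a * vertex R a = vertex R a := by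
  simpa [vertex, gen] using mkHom_eq_of_rel E (LeavittRel.idem (R := R) a)

theorem vertex_orth {a b : E.Vertex} (h : a ≠ b) : vertex R a * vertex R b = 0 := by
  simpa [vertex, gen] using mkHom_eq_of_rel E (LeavittRel.orth (R := R) a b h)

theorem source_edge (e : E.Edge) : vertex R (E.source e) * edge R e = edge R e := by
  simpa [vertex, edge, gen] using mkHom_eq_of_rel E (LeavittRel.source_edge (R := R) e)

theorem edge_range (e : E.Edge) : edge R e * vertex R (E.range e) = edge R e := by
  simpa [vertex, edge, gen] using mkHom_eq_of_rel E (LeavittRel.edge_range (R := R) e)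

theorem range_ghost (e : E.Edge) : vertex R (E.range e) * ghost R e = ghost R e := by
  simpa [vertex, ghost, gen] using mkHom_eq_of_rel E (LeavittRel.range_ghost (R := R) e)

theorem ghost_source (e : E.Edge) : ghost R e * vertex R (E.source e) = ghost R e := by
  simpa [vertex, ghost, gen] using mkHom_eq_of_rel E (LeavittRel.ghost_source (R := R) e)

theorem ck1_same (e : E.Edge) : ghost R e * edge R e = vertex R (E.range e) := by
  simpa [vertex, edge, ghost, gen] using mkHom_eq_of_rel E (LeavittRel.ck1_same (R := R) e)

theorem ck1_ne {e f : E.Edge} (h : e ≠ f) : ghost R e * edge R f = 0 := by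
  simpa [edge, ghost, gen] using mkHom_eq_of_rel E (LeavittRel.ck1_ne (R := R) e f h)

theorem ck2 (a : E.Vertex) (S : Finset E.Edge) (hS : ∀ e, e ∈ S ↔ E.source e = a)
    (hne : S.Nonempty) : vertex R a = ∑ e ∈ S, edge R e * ghost R e := by
  simpa [vertex, edge, ghost, gen, map_sum] using
    mkHom_eq_of_rel E (LeavittRel.ck2 (R := R) a S hS hne)

section Lift

variable {B : Type x} [NonUnitalRing B] [Module R B] [IsScalarTower R B B] [SMulCommClass R B B]

/-- A map from the generators to an `R`-algebra, extended to the free algebra. -/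
noncomputable def freeLift (f : E.LeavittGen → B) : FreeAssocAlgebra R E.LeavittGen →ₙₐ[R] B :=
  MonoidAlgebra.liftMagma R (FreeSemigroup.lift f)

@[simp]
theorem freeLift_of (f : E.LeavittGen → B) (a : E.LeavittGen) :
    freeLift (R := R) f (of R a) = f a := by
  simp [freeLift, FreeAssocAlgebra.of]

theorem freeHom_ext {f g : FreeAssocAlgebra R E.LeavittGen →ₙₐ[R] B}
    (h : ∀ a, f (of R a) = g (of R a)) : f = g := by
  apply (MonoidAlgebra.liftMagma R).symm.injective
  apply FreeSemigroup.hom_ext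
  funext a
  exact h a

/-- The Leavitt relations for a family indexed by the generators. -/
structure IsLeavittFamily (f : E.LeavittGen → B) : Prop where
  idem : ∀ a, f (.vertex a) * f (.vertex a) = f (.vertex a)
  orth : ∀ a b, a ≠ b → f (.vertex a) * f (.vertex b) = 0
  source_edge : ∀ e, f (.vertex (E.source e)) * f (.edge e) = f (.edge e)
  edge_range : ∀ e, f (.edge e) * f (.vertex (E.range e)) = f (.edge e)
  range_ghost : ∀ e, f (.vertex (E.range e)) * f (.ghost e) = f (.ghost e)
  ghost_source : ∀ e, f (.ghost e) * f (.vertex (E.source e)) = f (.ghost e)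
  ck1_same : ∀ e, f (.ghost e) * f (.edge e) = f (.vertex (E.range e))
  ck1_ne : ∀ e e', e ≠ e' → f (.ghost e) * f (.edge e') = 0
  ck2 : ∀ (a : E.Vertex) (S : Finset E.Edge), (∀ e, e ∈ S ↔ E.source e = a) → S.Nonempty →
    f (.vertex a) = ∑ e ∈ S, f (.edge e) * f (.ghost e)

theorem freeLift_rel {f : E.LeavittGen → B} (hf : IsLeavittFamily f)
    {p q : FreeAssocAlgebra R E.LeavittGen} (h : leavittCon R E p q) :
    freeLift (R := R) f p = freeLift (R := R) f q := by
  induction h with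
  | of p q h =>
    induction h with
    | idem a => simpa using hf.idem a
    | orth a b h => simpa using hf.orth a b h
    | source_edge e => simpa using hf.source_edge e
    | edge_range e => simpa using hf.edge_range e
    | range_ghost e => simpa using hf.range_ghost e
    | ghost_source e => simpa using hf.ghost_source e
    | ck1_same e => simpa using hf.ck1_same e
    | ck1_ne e e' h => simpa using hf.ck1_ne e e' h
    | ck2 a S hS hne => simpa [map_sum] using hf.ck2 a S hS hne
    | smul r _ ih => rw [map_smul, map_smul, ih]
  | refl p => rfl
  | symm _ ih => exact ih.symm
  | trans _ _ ih₁ ih₂ => exact ih₁.trans ih₂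
  | add _ _ ih₁ ih₂ => rw [map_add, map_add, ih₁, ih₂]
  | mul _ _ ih₁ ih₂ => rw [map_mul, map_mul, ih₁, ih₂]

/-- The universal property of `L_R(E)`: existence. -/
noncomputable def lift (f : E.LeavittGen → B) (hf : IsLeavittFamily f) :
    LeavittPathAlgebra R E →ₙₐ[R] B where
  toFun := Quotient.lift (freeLift (R := R) f) fun _ _ h => freeLift_rel hf h
  map_smul' r a := by
    obtain ⟨p, rfl⟩ := mk_surjective R E a
    exact map_smul (freeLift (R := R) f) r p
  map_zero' := map_zero (freeLift (R := R) f)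
  map_add' a b := by
    obtain ⟨p, rfl⟩ := mk_surjective R E a
    obtain ⟨q, rfl⟩ := mk_surjective R E b
    exact map_add (freeLift (R := R) f) p q
  map_mul' a b := by
    obtain ⟨p, rfl⟩ := mk_surjective R E a
    obtain ⟨q, rfl⟩ := mk_surjective R E b
    exact map_mul (freeLift (R := R) f) p q

@[simp]
theorem lift_gen (f : E.LeavittGen → B) (hf : IsLeavittFamily f) (a : E.LeavittGen) :
    lift (R := R) f hf (gen R a) = f a :=
  freeLift_of f a

/-- The universal property of `L_R(E)`: uniqueness. -/
theorem hom_ext {f g : LeavittPathAlgebra R E →ₙₐ[R] B} (h : ∀ a, f (gen R a) = g (gen R a)) :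
    f = g := by
  have key : f.comp (mkHom R E) = g.comp (mkHom R E) := freeHom_ext h
  ext a
  obtain ⟨p, rfl⟩ := mk_surjective R E a
  exact DFunLike.congr_fun key p

end Lift

/-- The involution on generators: `v ↦ v`, `e ↦ e*`, `e* ↦ e`. -/
def swapGen : E.LeavittGen → E.LeavittGen
  | .vertex a => .vertex a
  | .edge e => .ghost e
  | .ghost e => .edge e

theorem isLeavittFamily_op :
    IsLeavittFamily fun a : E.LeavittGen => MulOpposite.op (gen R (swapGen a)) where
  idem a := congrArg MulOpposite.op (vertex_idem a)
  orth _ _ h := congrArg MulOpposite.op (vertex_orth h.symm)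
  source_edge e := congrArg MulOpposite.op (ghost_source e)
  edge_range e := congrArg MulOpposite.op (range_ghost e)
  range_ghost e := congrArg MulOpposite.op (edge_range e)
  ghost_source e := congrArg MulOpposite.op (source_edge e)
  ck1_same e := congrArg MulOpposite.op (ck1_same e)
  ck1_ne _ _ h := congrArg MulOpposite.op (ck1_ne h.symm)
  ck2 a S hS hne := by
    have h := congrArg (MulOpposite.opAddEquiv (α := LeavittPathAlgebra R E))
      (ck2 (R := R) a S hS hne)
    rw [map_sum] at h
    exact h

/-- The involution as an algebra homomorphism into the opposite algebra. -/
noncomputable def starHom : LeavittPathAlgebra R E →ₙₐ[R] (LeavittPathAlgebra R E)ᵐᵒᵖ :=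
  lift _ isLeavittFamily_op

/-- `starHom` in the other direction. -/
noncomputable def starHomOp : (LeavittPathAlgebra R E)ᵐᵒᵖ →ₙₐ[R] LeavittPathAlgebra R E where
  toFun a := (starHom a.unop).unop
  map_smul' r a := by simp
  map_zero' := by simp
  map_add' a b := by simp
  map_mul' a b := by simp

theorem starHomOp_starHom (a : LeavittPathAlgebra R E) : starHomOp (starHom a) = a := by
  have h : starHomOp.comp starHom = NonUnitalAlgHom.id R (LeavittPathAlgebra R E) := by
    apply hom_ext
    intro a
    cases a <;> simp [starHomOp, starHom, swapGen]
  exact DFunLike.congr_fun h a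

/-- The `R`-linear involution of `L_R(E)`, an anti-automorphism fixing each vertex and exchanging `e` and `e*`;
hence `(α β*)* = β α*` for paths `α`, `β`. -/
noncomputable instance : StarRing (LeavittPathAlgebra R E) where
  star a := (starHom a).unop
  star_involutive a := starHomOp_starHom a
  star_mul a b := by simp
  star_add a b := by simp

theorem star_def (a : LeavittPathAlgebra R E) : star a = (starHom a).unop := rfl

@[simp]
theorem star_vertex (a : E.Vertex) : star (vertex R a) = vertex R a := by
  simp [star_def, starHom, vertex, swapGen]

@[simp]
theorem star_edge (e : E.Edge) : star (edge R e) = ghost R e := by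
  simp [star_def, starHom, edge, ghost, swapGen]

@[simp]
theorem star_ghost (e : E.Edge) : star (ghost R e) = edge R e := by
  simp [star_def, starHom, edge, ghost, swapGen]

theorem star_smul_eq (r : R) (a : LeavittPathAlgebra R E) : star (r • a) = r • star a := by
  simp [star_def]

variable (R)

/-- The element `e₁ e₂ ⋯ eₙ` of `L_R(E)` given by a path `l` ending at `b`; the path of length zero
at `b` gives the vertex `b`. (The trailing factor `b`
is absorbed by the last edge.) -/
noncomputable def path (l : List E.Edge) (b : E.Vertex) : LeavittPathAlgebra R E :=
  l.foldr (fun e p => edge R e * p) (vertex R b)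

variable (E)

/-- The standard generators `α β*`, for paths `α`, `β` with `r(α) = r(β)`. -/
def standardGenerators : Set (LeavittPathAlgebra R E) :=
  {g | ∃ (a b c : E.Vertex) (α β : List E.Edge), E.IsPath a α c ∧ E.IsPath b β c ∧
    g = path R α c * star (path R β c)}

/-- The commutative core `M_R(E)`: the `R`-subalgebra of `L_R(E)` generated by the normal
(`x x* = x* x`) standard generators. -/
noncomputable def commutativeCore : NonUnitalSubalgebra R (LeavittPathAlgebra R E) :=
  NonUnitalAlgebra.adjoin R {g | g ∈ standardGenerators R E ∧ g * star g = star g * g}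

end LeavittPathAlgebra

end Leavitt

/-! ### Paths, closed paths and exits. -/

namespace DirectedGraph

variable {E : DirectedGraph.{u, v}}

/-! The core of the proof is a reduction theorem, `reducesToVertex`: under Condition (L), every `x ≠
0` admits `a`, `b` in the algebra with `a * x * b = r • v`, where `v` is a vertex and `r ≠ 0`. If `Φ
x = 0`, then `Φ (r • v) = 0` as well, so (iii) forces injectivity; only products inside the algebra
are used, so `Φ` need not be linear. Conversely, every `r • v` with `r ≠ 0` is a nonzero element of
the commutative core (`smul_vertex_ne_zero`, `vertex_mem_commutativeCore`). Nonvanishing is seen in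
a representation on functions over a branching system.

The reduction has two stages. Right multiplication by edges removes ghost edges from `x`; if every
product with an edge vanishes, (CK2) and the independence of paths show that `x` is already a
combination of paths (`reducesToVertex_of_mem_ghostDegreeLE`). For such a combination, multiplying
by the adjoint of a shortest path leaves a multiple of a vertex plus closed paths. Every closed path
has an exit, and compressing by a path that leaves through it kills that term while keeping the
vertex term (`reducesToVertex_smul_vertex_add_sum`). -/

theorem IsPath.append {a b c : E.Vertex} {l m : List E.Edge} (hl : E.IsPath a l b)
    (hm : E.IsPath b m c) : E.IsPath a (l ++ m) c := by
  induction l generalizing a with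
  | nil => cases hl; exact hm
  | cons e l ih => exact ⟨hl.1, ih hl.2⟩

theorem isPath_append {a c : E.Vertex} {l m : List E.Edge} (h : E.IsPath a (l ++ m) c) :
    ∃ b, E.IsPath a l b ∧ E.IsPath b m c := by
  induction l generalizing a with
  | nil => exact ⟨a, rfl, h⟩
  | cons e l ih =>
    obtain ⟨b, h₁, h₂⟩ := ih h.2
    exact ⟨b, ⟨h.1, h₁⟩, h₂⟩

theorem IsPath.target_unique {a b c : E.Vertex} {l : List E.Edge} (hb : E.IsPath a l b)
    (hc : E.IsPath a l c) : b = c := by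
  induction l generalizing a with
  | nil => exact hb.symm.trans hc
  | cons e l ih => exact ih hb.2 hc.2

theorem IsExit.mono {l m : List E.Edge} {f : E.Edge} (h : E.IsExit l f) (hlm : l ⊆ m) :
    E.IsExit m f := by
  obtain ⟨e, he, h⟩ := h
  exact ⟨e, hlm he, h⟩

/-- Under Condition (L), every path that is closed or revisits a vertex has an exit. -/
theorem ConditionL.exists_isExit_aux (hE : E.ConditionL) (n : ℕ) :
    ∀ (l : List E.Edge), l.length ≤ n → ∀ a b, E.IsPath a l b →
      (¬ (l.map E.source).Nodup ∨ (a = b ∧ l ≠ [])) → ∃ f, E.IsExit l f := by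
  induction n with
  | zero =>
    intro l hl a b _ h
    obtain rfl : l = [] := List.length_eq_zero_iff.1 (by omega)
    simp at h
  | succ n ih =>
    intro l hl a b hp h
    by_cases hnd : (l.map E.source).Nodup
    · obtain ⟨rfl, hne⟩ := h.resolve_left (not_not.2 hnd)
      exact hE a l ⟨hp, hne, hnd⟩
    · cases l with
      | nil => simp at hnd
      | cons e l =>
        by_cases hnd' : (l.map E.source).Nodup
        · have hmem : E.source e ∈ l.map E.source := by
            by_contra hc
            exact hnd (List.nodup_cons.2 ⟨hc, hnd'⟩)
          obtain ⟨e', he', hs⟩ := List.mem_map.1 hmem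
          obtain ⟨l₂, l₃, rfl⟩ := List.append_of_mem he'
          obtain ⟨c, h₁, h₂⟩ := isPath_append hp.2
          obtain ⟨f, hf⟩ := ih (e :: l₂) (by simp at hl ⊢; omega) (E.source e) c ⟨rfl, h₁⟩
            (Or.inr ⟨hs.symm.trans h₂.1, by simp⟩)
          exact ⟨f, hf.mono (by simp)⟩
        · obtain ⟨f, hf⟩ := ih l (by simpa using hl) _ b hp.2 (Or.inl hnd')
          exact ⟨f, hf.mono (by simp)⟩

theorem ConditionL.exists_isExit (hE : E.ConditionL) {a : E.Vertex} {l : List E.Edge}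
    (hl : E.IsPath a l a) (hne : l ≠ []) : ∃ f, E.IsExit l f :=
  hE.exists_isExit_aux l.length l le_rfl a a hl (Or.inr ⟨rfl, hne⟩)

/-! ### Existence of a branching system. -/

/-- The codes of a vertex `a` that emits edges can be split into an edge out of `a` and a code. -/
theorem nonempty_codeEquiv (a : E.Vertex) (ha : Nonempty {e // E.source e = a}) :
    Nonempty (({e // E.source e = a} × (E.Edge ⊕ ℕ)) ≃ (E.Edge ⊕ ℕ)) := by
  rw [← Cardinal.eq, Cardinal.mk_prod, Cardinal.lift_id, Cardinal.lift_id]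
  -- The summand `ℕ` makes the set of codes infinite, so a nonempty factor of at most its size is
  -- absorbed.
  apply Cardinal.mul_eq_right (Cardinal.aleph0_le_mk _)
  · exact Cardinal.mk_le_of_injective (f := fun e => Sum.inl e.1)
      fun e f h => Subtype.ext (Sum.inl_injective h)
  · exact Cardinal.mk_ne_zero _

/-- A branching system for `E`: a set over the vertices whose points above a vertex emitting
edges are uniquely of the form `cons e x`, with `e` an edge out of this vertex and `x` a point
above the range of `e`. -/
structure BranchingSystem (E : DirectedGraph.{u, v}) where
  /-- the points -/
  Point : Type (max u v)
  /-- the vertex below a point -/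
  base : Point → E.Vertex
  /-- the first edge of a point, if there is one -/
  head : Point → Option E.Edge
  /-- the point without its first edge -/
  tail : Point → Point
  /-- the point with an edge put in front -/
  cons : E.Edge → Point → Point
  base_surjective : Function.Surjective base
  base_cons : ∀ e x, base x = E.range e → base (cons e x) = E.source e
  head_cons : ∀ e x, base x = E.range e → head (cons e x) = some e
  tail_cons : ∀ e x, base x = E.range e → tail (cons e x) = x
  base_eq : ∀ e x, head x = some e → base x = E.source e
  base_tail : ∀ e x, head x = some e → base (tail x) = E.range e
  cons_tail : ∀ e x, head x = some e → cons e (tail x) = x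
  exists_head : ∀ e x, base x = E.source e → ∃ f, head x = some f

-- Every vertex carries the same fibre of codes. Above a vertex that emits edges,
-- `nonempty_codeEquiv` reads a code as an edge followed by a code, which gives `head`, `tail` and
-- `cons`. Elsewhere the value of `tail` is arbitrary.
open Classical in
theorem nonempty_branchingSystem (E : DirectedGraph.{u, v}) : Nonempty (BranchingSystem E) := by
  have φ := fun (a : E.Vertex) (ha : Nonempty {e // E.source e = a}) =>
    Classical.choice (nonempty_codeEquiv a ha)
  refine ⟨{
    Point := E.Vertex × (E.Edge ⊕ ℕ)
    base := Prod.fst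
    head := fun x => if h : Nonempty {e // E.source e = x.1} then
      some ((φ x.1 h).symm x.2).1.1 else none
    tail := fun x => if h : Nonempty {e // E.source e = x.1} then
      (E.range ((φ x.1 h).symm x.2).1.1, ((φ x.1 h).symm x.2).2) else x
    cons := fun e x => (E.source e, φ (E.source e) ⟨e, rfl⟩ (⟨e, rfl⟩, x.2))
    base_surjective := fun a => ⟨(a, Sum.inr 0), rfl⟩
    base_cons := fun _ _ _ => rfl
    head_cons := ?_
    tail_cons := ?_
    base_eq := ?_
    base_tail := ?_
    cons_tail := ?_
    exists_head := ?_ }⟩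
  · intro e x _
    have h : Nonempty {f // E.source f = E.source e} := ⟨e, rfl⟩
    simp [h]
  · rintro e ⟨a, i⟩ hx
    have h : Nonempty {f // E.source f = E.source e} := ⟨e, rfl⟩
    simpa [h] using hx.symm
  · rintro e ⟨a, i⟩ hx
    dsimp only at hx
    split_ifs at hx with h
    cases hx
    exact ((φ a h).symm i).1.2.symm
  · rintro e ⟨a, i⟩ hx
    dsimp only at hx ⊢
    split_ifs at hx with h
    cases hx
    rw [dif_pos h]
  · rintro e ⟨a, i⟩ hx
    dsimp only at hx ⊢
    split_ifs at hx with h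
    obtain rfl := Option.some.inj hx
    rw [dif_pos h]
    -- The source of the head equals `a` only propositionally and `φ` depends on it, so the vertex
    -- is generalized before substituting.
    have key : ∀ (b : E.Vertex) (hb : E.source ((φ a h).symm i).1.1 = b)
        (h' : Nonempty {e // E.source e = b}),
        b = a → (b, φ b h' (⟨((φ a h).symm i).1.1, hb⟩, ((φ a h).symm i).2)) = (a, i) := by
      rintro b hb h' rfl
      simp
    exact key _ rfl _ ((φ a h).symm i).1.2
  · rintro e ⟨a, i⟩ hx
    have h : Nonempty {f // E.source f = a} := ⟨e, hx.symm⟩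
    exact ⟨_, dif_pos h⟩

end DirectedGraph

/-! ### The representation on a branching system. -/

namespace LeavittPathAlgebra

open DirectedGraph

variable {R : Type w} [CommRing R] {E : DirectedGraph.{u, v}}

open Classical in
/-- The operators by which the generators act on the functions on a branching system. -/
noncomputable def branchingOperator (X : BranchingSystem E) :
    E.LeavittGen → Module.End R (X.Point → R)
  | .vertex a =>
    { toFun := fun φ x => if X.base x = a then φ x else 0
      map_add' := fun φ ψ => by ext x; by_cases h : X.base x = a <;> simp [h]
      map_smul' := fun r φ => by ext x; by_cases h : X.base x = a <;> simp [h] }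
  | .edge e =>
    { toFun := fun φ x => if X.head x = some e then φ (X.tail x) else 0
      map_add' := fun φ ψ => by ext x; by_cases h : X.head x = some e <;> simp [h]
      map_smul' := fun r φ => by ext x; by_cases h : X.head x = some e <;> simp [h] }
  | .ghost e =>
    { toFun := fun φ x => if X.base x = E.range e then φ (X.cons e x) else 0
      map_add' := fun φ ψ => by ext x; by_cases h : X.base x = E.range e <;> simp [h]
      map_smul' := fun r φ => by ext x; by_cases h : X.base x = E.range e <;> simp [h] }

section

variable (X : BranchingSystem E)

open Classical in
theorem branchingOperator_vertex (a : E.Vertex) (φ : X.Point → R) (x : X.Point) :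
    branchingOperator X (.vertex a) φ x = if X.base x = a then φ x else 0 := rfl

open Classical in
theorem branchingOperator_edge (e : E.Edge) (φ : X.Point → R) (x : X.Point) :
    branchingOperator X (.edge e) φ x = if X.head x = some e then φ (X.tail x) else 0 := rfl

open Classical in
theorem branchingOperator_ghost (e : E.Edge) (φ : X.Point → R) (x : X.Point) :
    branchingOperator X (.ghost e) φ x = if X.base x = E.range e then φ (X.cons e x) else 0 := rfl

theorem isLeavittFamily_branchingOperator :
    IsLeavittFamily (branchingOperator (R := R) X) where
  idem a := by
    refine LinearMap.ext fun φ => funext fun x => ?_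
    simp only [Module.End.mul_apply, branchingOperator_vertex]
    split_ifs <;> rfl
  orth a b hab := by
    refine LinearMap.ext fun φ => funext fun x => ?_
    simp only [Module.End.mul_apply, branchingOperator_vertex]
    split_ifs with h₁ h₂
    · exact absurd (h₁.symm.trans h₂) hab
    all_goals rfl
  source_edge e := by
    refine LinearMap.ext fun φ => funext fun x => ?_
    simp only [Module.End.mul_apply, branchingOperator_vertex, branchingOperator_edge]
    split_ifs with h₁ h₂ h₂
    · rfl
    · rfl
    · exact absurd (X.base_eq e x h₂) h₁
    · rfl
  edge_range e := by
    refine LinearMap.ext fun φ => funext fun x => ?_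
    simp only [Module.End.mul_apply, branchingOperator_vertex, branchingOperator_edge]
    split_ifs with h₁ h₂
    · rfl
    · exact absurd (X.base_tail e x h₁) h₂
    · rfl
  range_ghost e := by
    refine LinearMap.ext fun φ => funext fun x => ?_
    simp only [Module.End.mul_apply, branchingOperator_vertex, branchingOperator_ghost]
    split_ifs <;> rfl
  ghost_source e := by
    refine LinearMap.ext fun φ => funext fun x => ?_
    simp only [Module.End.mul_apply, branchingOperator_vertex, branchingOperator_ghost]
    split_ifs with h₁ h₂
    · rfl
    · exact absurd (X.base_cons e x h₁) h₂
    · rfl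
  ck1_same e := by
    refine LinearMap.ext fun φ => funext fun x => ?_
    simp only [Module.End.mul_apply, branchingOperator_vertex, branchingOperator_ghost,
      branchingOperator_edge]
    by_cases h : X.base x = E.range e
    · simp only [h, if_true, X.head_cons e x h, X.tail_cons e x h]
    · simp only [h, if_false]
  ck1_ne e f hef := by
    refine LinearMap.ext fun φ => funext fun x => ?_
    simp only [Module.End.mul_apply, branchingOperator_ghost, branchingOperator_edge]
    by_cases h : X.base x = E.range e
    · simp [h, X.head_cons e x h, hef]
    · simp [h]
  ck2 a S hS hne := by
    classical
    refine LinearMap.ext fun φ => funext fun x => ?_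
    -- The operator `e e*` restricts a function to the points with head `e`. For `e ∈ S` these sets
    -- partition the fibre above `a`.
    have key : ∀ e, (branchingOperator (R := R) X (.edge e) *
        branchingOperator X (.ghost e) : Module.End R (X.Point → R)) φ x =
        if X.head x = some e then φ x else 0 := by
      intro e
      simp only [Module.End.mul_apply, branchingOperator_ghost, branchingOperator_edge]
      split_ifs with h₁ h₂
      · rw [X.cons_tail e x h₁]
      · exact absurd (X.base_tail e x h₁) h₂
      · rfl
    rw [LinearMap.sum_apply, Finset.sum_apply, Finset.sum_congr rfl fun e _ => key e,
      branchingOperator_vertex]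
    obtain ⟨e₀, he₀⟩ := hne
    split_ifs with h
    · obtain ⟨f, hf⟩ := X.exists_head e₀ x (h.trans ((hS e₀).1 he₀).symm)
      have hfS : f ∈ S := (hS f).2 ((X.base_eq f x hf).symm.trans h)
      rw [Finset.sum_eq_single_of_mem f hfS, if_pos hf]
      intro e _ hne
      rw [if_neg]
      rintro he
      exact hne (Option.some.inj (he.symm.trans hf))
    · refine (Finset.sum_eq_zero fun e he => if_neg fun h' => h ?_).symm
      exact (X.base_eq e x h').trans ((hS e).1 he)

end

/-- In the representation, `r • a` sends the constant function `1` to a function with value `r` at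
any point above `a`. -/
theorem smul_vertex_ne_zero (a : E.Vertex) {r : R} (hr : r ≠ 0) : r • vertex R a ≠ 0 := by
  intro h
  obtain ⟨X⟩ := nonempty_branchingSystem E
  obtain ⟨x, hx⟩ := X.base_surjective a
  have h' := congrArg (lift (R := R) _ (isLeavittFamily_branchingOperator (R := R) X)) h
  rw [map_smul, map_zero, vertex, lift_gen] at h'
  have h'' := congrFun (LinearMap.congr_fun h' fun _ => 1) x
  rw [LinearMap.smul_apply, Pi.smul_apply, branchingOperator_vertex, if_pos hx] at h''
  exact hr (by simpa using h'')

/-! ### Products of paths and ghost paths. -/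

theorem ghost_mul_vertex (e : E.Edge) {a : E.Vertex} (h : E.source e ≠ a) :
    ghost R e * vertex R a = 0 := by
  rw [← ghost_source, mul_assoc, vertex_orth h, mul_zero]

theorem vertex_mul_edge (e : E.Edge) {a : E.Vertex} (h : a ≠ E.source e) :
    vertex R a * edge R e = 0 := by
  rw [← source_edge, ← mul_assoc, vertex_orth h, zero_mul]

theorem path_nil (b : E.Vertex) : path R [] b = vertex R b := rfl

theorem path_cons (e : E.Edge) (l : List E.Edge) (b : E.Vertex) :
    path R (e :: l) b = edge R e * path R l b := rfl

theorem path_mul_vertex (l : List E.Edge) (b : E.Vertex) :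
    path R l b * vertex R b = path R l b := by
  induction l with
  | nil => exact vertex_idem b
  | cons e l ih => rw [path_cons, mul_assoc, ih]

theorem path_mul_vertex_of_ne (l : List E.Edge) {a b : E.Vertex} (h : b ≠ a) :
    path R l b * vertex R a = 0 := by
  rw [← path_mul_vertex, mul_assoc, vertex_orth h, mul_zero]

theorem vertex_mul_path {a b : E.Vertex} {l : List E.Edge} (h : E.IsPath a l b) :
    vertex R a * path R l b = path R l b := by
  cases l with
  | nil => cases h; exact vertex_idem a
  | cons e l => rw [path_cons, ← mul_assoc, ← h.1, source_edge]

theorem vertex_mul_path_or (c : E.Vertex) (l : List E.Edge) (b : E.Vertex) :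
    vertex R c * path R l b = path R l b ∨ vertex R c * path R l b = 0 := by
  cases l with
  | nil =>
    by_cases h : c = b
    · subst h; exact Or.inl (vertex_idem c)
    · exact Or.inr (vertex_orth h)
  | cons e l =>
    by_cases h : c = E.source e
    · subst h; left; rw [path_cons, ← mul_assoc, source_edge]
    · right; rw [path_cons, ← mul_assoc, vertex_mul_edge e h, zero_mul]

theorem path_mul_path {b c : E.Vertex} (l : List E.Edge) {m : List E.Edge}
    (hm : E.IsPath b m c) : path R l b * path R m c = path R (l ++ m) c := by
  induction l with
  | nil => exact vertex_mul_path hm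
  | cons e l ih => rw [path_cons, mul_assoc, ih, List.cons_append, path_cons]

/-- The element given by a list of edges is zero unless the list is a path. -/
theorem path_eq_zero {l : List E.Edge} {b : E.Vertex} (h : ¬ ∃ a, E.IsPath a l b) :
    path R l b = 0 := by
  induction l with
  | nil => exact absurd ⟨b, rfl⟩ h
  | cons e l ih =>
    by_cases hl : ∃ a, E.IsPath a l b
    · obtain ⟨a, ha⟩ := hl
      by_cases hea : E.range e = a
      · exact absurd ⟨E.source e, rfl, by rwa [hea]⟩ h
      · rw [path_cons, ← vertex_mul_path ha, ← edge_range, mul_assoc, ← mul_assoc (vertex R _),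
          vertex_orth hea, zero_mul, mul_zero]
    · rw [path_cons, ih hl, mul_zero]

theorem star_path_mul_path_append {a c d : E.Vertex} {l m : List E.Edge} (hl : E.IsPath a l c)
    (hm : E.IsPath c m d) : star (path R l c) * path R (l ++ m) d = path R m d := by
  induction l generalizing a with
  | nil => rw [path_nil, star_vertex]; exact vertex_mul_path hm
  | cons e l ih =>
    rw [path_cons, star_mul, star_edge, List.cons_append, path_cons, mul_assoc,
      ← mul_assoc (ghost R e), ck1_same, vertex_mul_path (hl.2.append hm), ih hl.2]

/-- Common initial edges cancel until the first disagreement, where `e* f = 0`. The length bound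
excludes `l` properly extending `m`, when a ghost path could survive. -/
theorem star_path_mul_path_eq_zero {b c d : E.Vertex} {l m : List E.Edge}
    (hm : E.IsPath b m d) (hlen : l.length ≤ m.length) (h : ¬ l <+: m) :
    star (path R l c) * path R m d = 0 := by
  induction l generalizing b m with
  | nil => exact absurd List.nil_prefix h
  | cons e l ih =>
    cases m with
    | nil => simp at hlen
    | cons f m =>
      rw [path_cons, star_mul, star_edge, path_cons, mul_assoc, ← mul_assoc (ghost R e)]
      by_cases hef : e = f
      · subst hef
        rw [ck1_same, vertex_mul_path hm.2]
        exact ih hm.2 (by simpa using hlen) fun hp => h (by simpa using hp)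
      · rw [ck1_ne hef, zero_mul, mul_zero]

/-! ### Reduction of combinations of paths. -/

/-- `x` can be multiplied, on both sides, to a nonzero multiple of a vertex. -/
def ReducesToVertex (x : LeavittPathAlgebra R E) : Prop :=
  ∃ (a b : LeavittPathAlgebra R E) (u : E.Vertex) (r : R), r ≠ 0 ∧ a * x * b = r • vertex R u

theorem ReducesToVertex.of_mul_left {a x : LeavittPathAlgebra R E}
    (h : ReducesToVertex (a * x)) : ReducesToVertex x := by
  obtain ⟨c, d, u, r, hr, h⟩ := h
  exact ⟨c * a, d, u, r, hr, by rw [mul_assoc c, h]⟩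

theorem ReducesToVertex.of_mul_right {b x : LeavittPathAlgebra R E}
    (h : ReducesToVertex (x * b)) : ReducesToVertex x := by
  obtain ⟨c, d, u, r, hr, h⟩ := h
  exact ⟨c, b * d, u, r, hr, by rw [← h]; simp only [mul_assoc]⟩

theorem ReducesToVertex.ne_zero {x : LeavittPathAlgebra R E} (h : ReducesToVertex x) : x ≠ 0 := by
  rintro rfl
  obtain ⟨c, d, u, r, hr, h⟩ := h
  exact smul_vertex_ne_zero u hr (by rw [← h, mul_zero, zero_mul])

variable (R) in
/-- The multiples of closed paths of positive length at `a`. -/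
def closedPathMultiples (a : E.Vertex) : Set (LeavittPathAlgebra R E) :=
  {z | z = 0 ∨ ∃ (c : R) (l : List E.Edge), E.IsPath a l a ∧ l ≠ [] ∧ z = c • path R l a}

/-- Either `l m = m l'`, and then `m* l m = l'` is a closed path as long as `l`, or `l m` does not
begin with `m` and the product vanishes. -/
theorem star_path_mul_mul_path_mem {a b : E.Vertex} {m : List E.Edge} (hm : E.IsPath a m b)
    {z : LeavittPathAlgebra R E} (hz : z ∈ closedPathMultiples R a) :
    star (path R m b) * z * path R m b ∈ closedPathMultiples R b := by
  obtain rfl | ⟨c, l, hl, hne, rfl⟩ := hz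
  · left; simp
  rw [mul_smul_comm, smul_mul_assoc, mul_assoc, path_mul_path l hm]
  by_cases hp : m <+: l ++ m
  · obtain ⟨l', hl'⟩ := hp
    have h := hl.append hm
    rw [← hl'] at h
    obtain ⟨b', h₁, h₂⟩ := isPath_append h
    obtain rfl := hm.target_unique h₁
    refine Or.inr ⟨c, l', h₂, ?_, by rw [← hl', star_path_mul_path_append hm h₂]⟩
    rintro rfl
    have := congrArg List.length hl'
    simp at this
    exact hne this
  · left
    rw [star_path_mul_path_eq_zero (hl.append hm) (by simp) hp, smul_zero]

/-- If `l = s e t` has exit `f` at `e`, take `m = s f`: the path `l m` continues after `s` with `e ≠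
f`, so it does not begin with `m`. -/
theorem exists_star_path_mul_mul_path_eq_zero (hE : E.ConditionL) {a : E.Vertex}
    {z : LeavittPathAlgebra R E} (hz : z ∈ closedPathMultiples R a) :
    ∃ (m : List E.Edge) (b : E.Vertex), E.IsPath a m b ∧
      star (path R m b) * z * path R m b = 0 := by
  obtain rfl | ⟨c, l, hl, hne, rfl⟩ := hz
  · exact ⟨[], a, rfl, by simp⟩
  obtain ⟨f, e, he, hs, hfe⟩ := hE.exists_isExit hl hne
  obtain ⟨s, t, rfl⟩ := List.append_of_mem he
  obtain ⟨b, h₁, h₂⟩ := isPath_append hl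
  have hm : E.IsPath a (s ++ [f]) (E.range f) := h₁.append ⟨hs.trans h₂.1, rfl⟩
  refine ⟨s ++ [f], E.range f, hm, ?_⟩
  rw [mul_smul_comm, smul_mul_assoc, mul_assoc, path_mul_path _ hm,
    star_path_mul_path_eq_zero (hl.append hm) (by simp) ?_, smul_zero]
  rw [List.append_assoc, List.prefix_append_right_inj]
  simp [hfe]

/-- Each compression `m* · m` kills one summand, turns `r • a` into `r • b`, and keeps the other
summands zero or multiples of closed paths, so induction on the number of summands applies. -/
theorem reducesToVertex_smul_vertex_add_sum (hE : E.ConditionL) {ι : Type*} {r : R} (hr : r ≠ 0)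
    (S : Finset ι) : ∀ (a : E.Vertex) (z : ι → LeavittPathAlgebra R E),
      (∀ i, z i ∈ closedPathMultiples R a) →
      ReducesToVertex (r • vertex R a + ∑ i ∈ S, z i) := by
  classical
  induction S using Finset.induction_on with
  | empty =>
    intro a z _
    refine ⟨vertex R a, vertex R a, a, r, hr, ?_⟩
    rw [Finset.sum_empty, add_zero, mul_smul_comm, smul_mul_assoc, vertex_idem, vertex_idem]
  | insert i S hi ih =>
    intro a z hz
    obtain ⟨m, b, hm, h₀⟩ := exists_star_path_mul_mul_path_eq_zero hE (hz i)
    have h := ih b (fun j => star (path R m b) * z j * path R m b)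
      fun j => star_path_mul_mul_path_mem hm (hz j)
    have h₁ : star (path R m b) * vertex R a * path R m b = vertex R b := by
      have := star_path_mul_path_append (R := R) hm (m := []) rfl
      rw [List.append_nil] at this
      rw [mul_assoc, vertex_mul_path hm, this, path_nil]
    refine ReducesToVertex.of_mul_left (a := star (path R m b))
      (ReducesToVertex.of_mul_right (b := path R m b) ?_)
    rwa [Finset.sum_insert hi, mul_add, mul_add, add_mul, add_mul, h₀, zero_add, mul_smul_comm,
      smul_mul_assoc, h₁, Finset.mul_sum, Finset.sum_mul]

/-- A formally nonzero combination of paths ending at `a` reduces to a vertex. -/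
theorem reducesToVertex_linearCombination (hE : E.ConditionL) {a : E.Vertex}
    {p : List E.Edge →₀ R} (hp : ∀ l ∈ p.support, ∃ b, E.IsPath b l a) (hp0 : p ≠ 0) :
    ReducesToVertex (Finsupp.linearCombination R (fun l => path R l a) p) := by
  classical
  have hne : p.support.Nonempty := Finsupp.support_nonempty_iff.2 hp0
  -- With `m` of minimal length, `m* l` is either zero or the remainder of `l` after `m`, so no
  -- ghost edges appear.
  obtain ⟨m, hm, hmin⟩ := p.support.exists_min_image List.length hne
  obtain ⟨b, hb⟩ := hp m hm
  refine ReducesToVertex.of_mul_left (a := star (path R m a)) ?_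
  rw [Finsupp.linearCombination_apply, Finsupp.sum, Finset.mul_sum,
    ← Finset.add_sum_erase _ _ hm, mul_smul_comm]
  have h₁ : star (path R m a) * path R m a = vertex R a := by
    have := star_path_mul_path_append (R := R) hb (m := []) rfl
    rwa [List.append_nil] at this
  rw [h₁]
  let z : List E.Edge → LeavittPathAlgebra R E := fun l =>
    if l ∈ p.support.erase m then star (path R m a) * p l • path R l a else 0
  have hz : ∀ l, z l ∈ closedPathMultiples R a := by
    intro l
    by_cases hl : l ∈ p.support.erase m
    · simp only [z, if_pos hl]
      obtain ⟨hlm, hl⟩ := Finset.mem_erase.1 hl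
      obtain ⟨c, hc⟩ := hp l hl
      by_cases hpre : m <+: l
      · obtain ⟨l', rfl⟩ := hpre
        -- The sources can differ only if `m` is empty, since the empty list is a prefix of every
        -- path.
        by_cases hbc : b = c
        · subst hbc
          obtain ⟨b', h₂, h₃⟩ := isPath_append hc
          obtain rfl := hb.target_unique h₂
          exact Or.inr ⟨p (m ++ l'), l', h₃, fun h => hlm (by simp [h]), by
            rw [mul_smul_comm, star_path_mul_path_append hb h₃]⟩
        · left
          rw [mul_smul_comm, ← vertex_mul_path hc, ← vertex_mul_path hb, star_mul, star_vertex,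
            mul_assoc, ← mul_assoc (vertex R b), vertex_orth hbc, zero_mul, mul_zero, smul_zero]
      · left
        rw [mul_smul_comm, star_path_mul_path_eq_zero hc (hmin l hl) hpre, smul_zero]
    · simp only [z, if_neg hl]
      exact Or.inl rfl
  have h := reducesToVertex_smul_vertex_add_sum hE (Finsupp.mem_support_iff.1 hm)
    (p.support.erase m) a z hz
  rwa [Finset.sum_congr rfl fun l hl => if_pos hl] at h

/-! ### Reduction of general elements by ghost length. -/

variable (R E) in
/-- The span of the products `α β*` with `β` of length at most `n`. -/
noncomputable def ghostDegreeLE (n : ℕ) : Submodule R (LeavittPathAlgebra R E) :=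
  Submodule.span R {x | ∃ (l m : List E.Edge) (c : E.Vertex), m.length ≤ n ∧
    x = path R l c * star (path R m c)}

theorem mem_ghostDegreeLE {n : ℕ} (l : List E.Edge) {m : List E.Edge} (c : E.Vertex)
    (h : m.length ≤ n) : path R l c * star (path R m c) ∈ ghostDegreeLE R E n :=
  Submodule.subset_span ⟨l, m, c, h, rfl⟩

theorem ghostDegreeLE_mono : Monotone (ghostDegreeLE R E) := by
  intro n n' h
  apply Submodule.span_mono
  rintro _ ⟨l, m, c, hm, rfl⟩
  exact ⟨l, m, c, hm.trans h, rfl⟩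

theorem path_mem_ghostDegreeLE (n : ℕ) (l : List E.Edge) (c : E.Vertex) :
    path R l c ∈ ghostDegreeLE R E n := by
  have := mem_ghostDegreeLE (R := R) (n := n) l (m := []) c (Nat.zero_le _)
  rwa [path_nil, star_vertex, path_mul_vertex] at this

/-- In `α β* e`, the edge either meets the first edge of `β`, cancelling it or giving zero, or, when
`β` is trivial, extends `α` or gives zero. -/
theorem mul_edge_mem_ghostDegreeLE {n : ℕ} {x : LeavittPathAlgebra R E}
    (hx : x ∈ ghostDegreeLE R E (n + 1)) (e : E.Edge) : x * edge R e ∈ ghostDegreeLE R E n := by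
  induction hx using Submodule.span_induction with
  | zero => rw [zero_mul]; exact zero_mem _
  | add x y _ _ hx hy => rw [add_mul]; exact add_mem hx hy
  | smul r x _ hx => rw [smul_mul_assoc]; exact Submodule.smul_mem _ r hx
  | mem x h =>
    obtain ⟨l, m, c, hm, rfl⟩ := h
    cases m with
    | nil =>
      rw [path_nil, star_vertex, path_mul_vertex]
      by_cases hc : c = E.source e
      · have h₁ : edge R e = path R [e] (E.range e) := by rw [path_cons, path_nil, edge_range]
        rw [h₁, path_mul_path l (show E.IsPath c [e] (E.range e) from ⟨hc.symm, rfl⟩)]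
        exact path_mem_ghostDegreeLE n _ _
      · rw [← path_mul_vertex, mul_assoc, vertex_mul_edge e hc, mul_zero]
        exact zero_mem _
    | cons f m =>
      rw [path_cons, star_mul, star_edge, mul_assoc, mul_assoc]
      by_cases hf : f = e
      · subst hf
        rw [ck1_same]
        have h₁ : star (path R m c) * vertex R (E.range f) =
            star (vertex R (E.range f) * path R m c) := by rw [star_mul, star_vertex]
        rw [h₁]
        obtain h | h := vertex_mul_path_or (R := R) (E.range f) m c
        · rw [h]; exact mem_ghostDegreeLE l c (by simpa using hm)
        · rw [h, star_zero, mul_zero]; exact zero_mem _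
      · rw [ck1_ne hf, mul_zero, mul_zero]
        exact zero_mem _

/-- Up to a combination of paths, `x` is the sum of its components `x e e*` for finitely many
edges `e`. -/
theorem exists_sub_eq_sum {n : ℕ} {x : LeavittPathAlgebra R E} (hx : x ∈ ghostDegreeLE R E n) :
    -- Allowing every larger `T` lets the edge sets of two summands be merged.
    ∃ y ∈ ghostDegreeLE R E 0, ∃ S : Finset E.Edge, ∀ T, S ⊆ T →
      x - y = ∑ e ∈ T, (x - y) * edge R e * ghost R e := by
  classical
  induction hx using Submodule.span_induction with
  | zero => exact ⟨0, zero_mem _, ∅, fun T _ => by simp⟩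
  | add x x' _ _ hx hx' =>
    obtain ⟨y, hy, S, h⟩ := hx
    obtain ⟨y', hy', S', h'⟩ := hx'
    refine ⟨y + y', add_mem hy hy', S ∪ S', fun T hT => ?_⟩
    rw [add_sub_add_comm]
    simp only [add_mul, Finset.sum_add_distrib]
    rw [← h T (Finset.union_subset_left hT), ← h' T (Finset.union_subset_right hT)]
  | smul r x _ hx =>
    obtain ⟨y, hy, S, h⟩ := hx
    refine ⟨r • y, Submodule.smul_mem _ r hy, S, fun T hT => ?_⟩
    rw [← smul_sub]
    simp only [smul_mul_assoc]
    rw [← Finset.smul_sum, ← h T hT]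
  | mem x h =>
    obtain ⟨l, m, c, hm, rfl⟩ := h
    cases m with
    | nil =>
      refine ⟨_, mem_ghostDegreeLE l (m := []) c (Nat.zero_le _), ∅, fun T _ => ?_⟩
      rw [sub_self]
      simp
    | cons f m =>
      refine ⟨0, zero_mem _, {f}, fun T hT => ?_⟩
      rw [sub_zero, path_cons, star_mul, star_edge, Finset.sum_eq_single_of_mem f (hT (by simp))]
      · simp only [mul_assoc]
        rw [← mul_assoc (ghost R f), ck1_same, range_ghost]
      · intro e _ he
        simp only [mul_assoc]
        rw [← mul_assoc (ghost R f), ck1_ne he.symm, zero_mul, mul_zero, mul_zero]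

theorem mul_vertex_mem_span_path {x : LeavittPathAlgebra R E} (hx : x ∈ ghostDegreeLE R E 0)
    (a : E.Vertex) : x * vertex R a ∈ Submodule.span R
      ((fun l => path R l a) '' {l : List E.Edge | ∃ b, E.IsPath b l a}) := by
  induction hx using Submodule.span_induction with
  | zero => rw [zero_mul]; exact zero_mem _
  | add x y _ _ hx hy => rw [add_mul]; exact add_mem hx hy
  | smul r x _ hx => rw [smul_mul_assoc]; exact Submodule.smul_mem _ r hx
  | mem x h =>
    obtain ⟨l, m, c, hm, rfl⟩ := h
    obtain rfl : m = [] := List.length_eq_zero_iff.1 (by omega)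
    rw [path_nil, star_vertex, path_mul_vertex]
    by_cases hc : c = a
    · subst hc
      rw [path_mul_vertex]
      by_cases hl : ∃ b, E.IsPath b l c
      · exact Submodule.subset_span ⟨l, hl, rfl⟩
      · rw [path_eq_zero hl]; exact zero_mem _
    · rw [path_mul_vertex_of_ne l hc]; exact zero_mem _

theorem exists_mul_vertex_eq_linearCombination {x : LeavittPathAlgebra R E}
    (hx : x ∈ ghostDegreeLE R E 0) (a : E.Vertex) :
    ∃ p : List E.Edge →₀ R, (∀ l ∈ p.support, ∃ b, E.IsPath b l a) ∧
      x * vertex R a = Finsupp.linearCombination R (fun l => path R l a) p := by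
  obtain ⟨p, hp, h⟩ := (Finsupp.mem_span_image_iff_linearCombination R).1
    (mul_vertex_mem_span_path hx a)
  exact ⟨p, fun l hl => hp hl, h.symm⟩

theorem reducesToVertex_mul_vertex (hE : E.ConditionL) (a : E.Vertex)
    {y : LeavittPathAlgebra R E} (hy : y ∈ ghostDegreeLE R E 0) (h : y * vertex R a ≠ 0) :
    ReducesToVertex (y * vertex R a) := by
  obtain ⟨p, hp, hyp⟩ := exists_mul_vertex_eq_linearCombination hy a
  rw [hyp]
  apply reducesToVertex_linearCombination hE hp
  rintro rfl
  exact h (by rw [hyp, map_zero])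

/-- Appending `f` is injective on lists, so the formal combination stays nonzero, and formally
nonzero combinations of paths do not vanish in the algebra. -/
theorem mul_edge_ne_zero (hE : E.ConditionL) {y : LeavittPathAlgebra R E}
    (hy : y ∈ ghostDegreeLE R E 0) (f : E.Edge) (h : y * vertex R (E.source f) ≠ 0) :
    y * edge R f ≠ 0 := by
  classical
  obtain ⟨p, hp, hyp⟩ := exists_mul_vertex_eq_linearCombination hy (E.source f)
  have hinj : Function.Injective fun l : List E.Edge => l ++ [f] :=
    fun _ _ h => List.append_cancel_right h
  have h₁ : y * edge R f = Finsupp.linearCombination R (fun l => path R l (E.range f))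
      (p.mapDomain fun l => l ++ [f]) := by
    rw [← source_edge, ← mul_assoc, hyp, Finsupp.linearCombination_mapDomain,
      Finsupp.linearCombination_apply, Finsupp.linearCombination_apply, Finsupp.sum, Finsupp.sum,
      Finset.sum_mul]
    refine Finset.sum_congr rfl fun l _ => ?_
    have h₂ : edge R f = path R [f] (E.range f) := by rw [path_cons, path_nil, edge_range]
    rw [smul_mul_assoc, h₂,
      path_mul_path l (show E.IsPath (E.source f) [f] (E.range f) from ⟨rfl, rfl⟩)]
    rfl
  rw [h₁]
  refine (reducesToVertex_linearCombination hE ?_ ?_).ne_zero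
  · intro l hl
    obtain ⟨l', hl', rfl⟩ := Finset.mem_image.1 (Finsupp.mapDomain_support hl)
    obtain ⟨b, hb⟩ := hp l' hl'
    exact ⟨b, hb.append ⟨rfl, rfl⟩⟩
  · intro h0
    rw [Finsupp.mapDomain_injective hinj (h0.trans Finsupp.mapDomain_zero.symm)] at hyp
    exact h (by rw [hyp, map_zero])

theorem reducesToVertex_of_mem_ghostDegreeLE (hE : E.ConditionL) (n : ℕ) :
    ∀ (a : E.Vertex) (x : LeavittPathAlgebra R E), x ∈ ghostDegreeLE R E n →
      x * vertex R a = x → x ≠ 0 → ReducesToVertex x := by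
  induction n with
  | zero =>
    intro a x hx hxa hx0
    rw [← hxa] at hx0 ⊢
    exact reducesToVertex_mul_vertex hE a hx hx0
  | succ n ih =>
    intro a x hx hxa hx0
    by_cases hxe : ∃ e, x * edge R e ≠ 0
    · obtain ⟨e, he⟩ := hxe
      refine ReducesToVertex.of_mul_right (b := edge R e)
        (ih (E.range e) _ (mul_edge_mem_ghostDegreeLE hx e) ?_ he)
      rw [mul_assoc, edge_range]
    push Not at hxe
    obtain ⟨y, hy, S, hS⟩ := exists_sub_eq_sum hx
    -- Now `x e = 0` for every edge, so `(x - y) e = -(y e)` and only `y` enters the decomposition.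
    have hxy : x = y * vertex R a - ∑ e ∈ S, y * edge R e * (ghost R e * vertex R a) := by
      have h := congrArg (· * vertex R a) (hS S subset_rfl)
      simp only [sub_mul, hxe, zero_sub, Finset.sum_neg_distrib, neg_mul,
        Finset.sum_mul, hxa] at h
      simp only [← mul_assoc]
      rw [eq_add_of_sub_eq h, neg_add_eq_sub]
    by_cases hya : y * vertex R a = 0
    · refine absurd ?_ hx0
      rw [hxy, hya, zero_sub, neg_eq_zero]
      refine Finset.sum_eq_zero fun e _ => ?_
      by_cases he : E.source e = a
      · rw [← source_edge, ← mul_assoc y, he, hya, zero_mul, zero_mul]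
      · rw [ghost_mul_vertex e he, mul_zero]
    · by_cases hex : ∃ f, E.source f = a
      -- An edge `f` out of `a` outside `S` would give `(x - y) f = 0`, hence `y f = 0`. So `a`
      -- emits finitely many edges, and (CK2) at `a` forces `x = 0`.
      · have hmem : ∀ f, E.source f = a → f ∈ S := by
          rintro f rfl
          by_contra hf
          apply mul_edge_ne_zero hE hy f hya
          have h := congrArg (· * edge R f) (hS S subset_rfl)
          simp only [sub_mul, hxe, zero_sub, Finset.sum_mul, neg_mul] at h
          rw [← neg_eq_zero, h]
          refine Finset.sum_eq_zero fun e he => ?_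
          rw [mul_assoc, ck1_ne (fun h' : e = f => hf (h' ▸ he)), mul_zero, neg_zero]
        classical
        obtain ⟨f, hf⟩ := hex
        refine absurd ?_ hx0
        rw [← hxa, ck2 a (S.filter fun e => E.source e = a)
          (fun e => ⟨fun h => (Finset.mem_filter.1 h).2,
            fun h => Finset.mem_filter.2 ⟨hmem e h, h⟩⟩)
          ⟨f, Finset.mem_filter.2 ⟨hmem f hf, hf⟩⟩, Finset.mul_sum]
        exact Finset.sum_eq_zero fun e _ => by rw [← mul_assoc, hxe, zero_mul]
      · push Not at hex
        have h : x = y * vertex R a := by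
          rw [hxy, sub_eq_self]
          exact Finset.sum_eq_zero fun e _ => by rw [ghost_mul_vertex e (hex e), mul_zero]
        rw [h]
        exact reducesToVertex_mul_vertex hE a hy hya

/-! ### Spanning by the products `α β*`, local units and the reduction theorem. -/

/-- A submodule that contains the generators and is stable under left multiplication by them
contains every element. -/
theorem mem_of_gen_mul_mem (M : Submodule R (LeavittPathAlgebra R E))
    (hgen : ∀ g, gen R g ∈ M) (hmul : ∀ g, ∀ x ∈ M, gen R g * x ∈ M)
    (x : LeavittPathAlgebra R E) : x ∈ M := by
  obtain ⟨p, rfl⟩ := mk_surjective R E x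
  change mkHom R E p ∈ M
  have hword : ∀ w : FreeSemigroup E.LeavittGen,
      mkHom R E (MonoidAlgebra.ofMagma R _ w) ∈ M := by
    intro w
    induction w using FreeSemigroup.recOnMul with
    | ih1 g => exact hgen g
    | ih2 g w _ hw =>
      rw [map_mul, map_mul]
      exact hmul g _ hw
  induction p using MonoidAlgebra.induction_linear with
  | zero => rw [map_zero]; exact zero_mem _
  | add p q hp hq => rw [map_add]; exact add_mem hp hq
  | single w r =>
    have h : (MonoidAlgebra.single w r : FreeAssocAlgebra R E.LeavittGen) =
        r • MonoidAlgebra.ofMagma R _ w := by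
      simp [MonoidAlgebra.ofMagma_apply]
    rw [h, map_smul]
    exact Submodule.smul_mem _ r (hword w)

theorem exists_mem_ghostDegreeLE (x : LeavittPathAlgebra R E) :
    ∃ n, x ∈ ghostDegreeLE R E n := by
  have hdir : Directed (· ≤ ·) (ghostDegreeLE R E) := ghostDegreeLE_mono.directed_le
  suffices h : x ∈ ⨆ n, ghostDegreeLE R E n from (Submodule.mem_iSup_of_directed _ hdir).1 h
  have hle : ∀ n, ghostDegreeLE R E n ≤ ⨆ n, ghostDegreeLE R E n := le_iSup _
  apply mem_of_gen_mul_mem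
  · rintro (a | e | e)
    · exact hle 0 (path_mem_ghostDegreeLE 0 [] a)
    · have := path_mem_ghostDegreeLE (R := R) 0 [e] (E.range e)
      rw [path_cons, path_nil, edge_range] at this
      exact hle 0 this
    · have := mem_ghostDegreeLE (R := R) (n := 1) [] (m := [e]) (E.range e) (by simp)
      rw [path_cons, path_nil, edge_range, star_edge, range_ghost] at this
      exact hle 1 this
  · intro g x hx
    obtain ⟨n, hxn⟩ := (Submodule.mem_iSup_of_directed _ hdir).1 hx
    clear hx
    -- A ghost edge in front of a trivial `α` lengthens `β` by one edge.
    refine hle (n + 1) ?_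
    induction hxn using Submodule.span_induction with
    | zero => rw [mul_zero]; exact zero_mem _
    | add x y _ _ hx hy => rw [mul_add]; exact add_mem hx hy
    | smul r x _ hx => rw [mul_smul_comm]; exact Submodule.smul_mem _ r hx
    | mem x h =>
      obtain ⟨l, m, c, hm, rfl⟩ := h
      rw [← mul_assoc]
      obtain a | e | e := g
      · change vertex R a * _ * _ ∈ _
        obtain h | h := vertex_mul_path_or (R := R) a l c
        · rw [h]; exact mem_ghostDegreeLE l c (by omega)
        · rw [h, zero_mul]; exact zero_mem _
      · exact mem_ghostDegreeLE (e :: l) c (by omega)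
      · change ghost R e * _ * _ ∈ _
        cases l with
        | nil =>
          by_cases hc : E.source e = c
          · have h : ghost R e * path R [] c * star (path R m c) =
                path R [] (E.range e) * star (path R (m ++ [e]) (E.range e)) := by
              rw [← path_mul_path (b := c) m (show E.IsPath c [e] (E.range e) from ⟨hc, rfl⟩),
                path_cons, path_nil, path_nil, edge_range, star_mul, star_edge, ← mul_assoc,
                range_ghost, ← hc, ghost_source]
            rw [h]
            exact mem_ghostDegreeLE [] _ (by simpa using hm)
          · rw [path_nil, ghost_mul_vertex e hc, zero_mul]
            exact zero_mem _
        | cons f l =>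
          rw [path_cons, ← mul_assoc]
          by_cases hf : e = f
          · subst hf
            rw [ck1_same]
            obtain h | h := vertex_mul_path_or (R := R) (E.range e) l c
            · rw [h]; exact mem_ghostDegreeLE l c (by omega)
            · rw [h, zero_mul]; exact zero_mem _
          · rw [ck1_ne hf, zero_mul, zero_mul]
            exact zero_mem _

/-- Finite sums of vertices act as local units: `α β*` is fixed on the right by the source of `β`.
This replaces a global unit when choosing a vertex with `x a ≠ 0`. -/
theorem exists_eq_sum_mul_vertex (x : LeavittPathAlgebra R E) :
    ∃ F : Finset E.Vertex, ∀ T, F ⊆ T → x = ∑ a ∈ T, x * vertex R a := by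
  classical
  obtain ⟨n, hx⟩ := exists_mem_ghostDegreeLE x
  induction hx using Submodule.span_induction with
  | zero => exact ⟨∅, fun T _ => by simp⟩
  | add x y _ _ hx hy =>
    obtain ⟨F, hF⟩ := hx
    obtain ⟨F', hF'⟩ := hy
    refine ⟨F ∪ F', fun T hT => ?_⟩
    simp only [add_mul, Finset.sum_add_distrib]
    rw [← hF T (Finset.union_subset_left hT), ← hF' T (Finset.union_subset_right hT)]
  | smul r x _ hx =>
    obtain ⟨F, hF⟩ := hx
    refine ⟨F, fun T hT => ?_⟩
    simp only [smul_mul_assoc]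
    rw [← Finset.smul_sum, ← hF T hT]
  | mem x h =>
    obtain ⟨l, m, c, _, rfl⟩ := h
    by_cases hm : ∃ b, E.IsPath b m c
    · obtain ⟨b, hb⟩ := hm
      have h : ∀ a, star (path R m c) * vertex R a = star (vertex R a * path R m c) := fun a => by
        rw [star_mul, star_vertex]
      refine ⟨{b}, fun T hT => ?_⟩
      rw [Finset.sum_eq_single_of_mem b (hT (by simp)), mul_assoc, h, vertex_mul_path hb]
      intro a _ hab
      rw [mul_assoc, h, ← vertex_mul_path hb, ← mul_assoc, vertex_orth hab, zero_mul, star_zero,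
        mul_zero]
    · exact ⟨∅, fun T _ => by simp [path_eq_zero hm]⟩

/-- Under Condition (L), every nonzero element reduces to a vertex. -/
theorem reducesToVertex (hE : E.ConditionL) {x : LeavittPathAlgebra R E} (hx : x ≠ 0) :
    ReducesToVertex x := by
  obtain ⟨F, hF⟩ := exists_eq_sum_mul_vertex x
  obtain ⟨a, ha⟩ : ∃ a, x * vertex R a ≠ 0 := by
    by_contra! h
    exact hx ((hF F subset_rfl).trans (Finset.sum_eq_zero fun a _ => h a))
  obtain ⟨n, hn⟩ := exists_mem_ghostDegreeLE (x * vertex R a)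
  exact (reducesToVertex_of_mem_ghostDegreeLE hE n a _ hn
    (by rw [mul_assoc, vertex_idem]) ha).of_mul_right

/-! ### The uniqueness theorem. -/

theorem vertex_mem_commutativeCore (a : E.Vertex) : vertex R a ∈ commutativeCore R E := by
  apply NonUnitalAlgebra.subset_adjoin
  refine ⟨⟨a, a, a, [], [], rfl, rfl, ?_⟩, by rw [star_vertex]⟩
  rw [path_nil, star_vertex, vertex_idem]

end LeavittPathAlgebra

theorem mainTheorem6 {R : Type w} [CommRing R] (E : DirectedGraph.{u, v}) (hE : E.ConditionL)
    {A : Type x} [NonUnitalRing A] (Φ : LeavittPathAlgebra R E →ₙ+* A) :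
    List.TFAE [
      Function.Injective Φ,
      Set.InjOn Φ (LeavittPathAlgebra.commutativeCore R E : Set (LeavittPathAlgebra R E)),
      ∀ (a : E.Vertex) (r : R), r ≠ 0 → Φ (r • LeavittPathAlgebra.vertex R a) ≠ 0] := by
  tfae_have 1 → 2 := fun h => h.injOn
  tfae_have 2 → 3 := by
    intro h a r hr h0
    refine LeavittPathAlgebra.smul_vertex_ne_zero a hr (h ?_ (zero_mem _) (by rw [h0, map_zero]))
    exact SMulMemClass.smul_mem r (LeavittPathAlgebra.vertex_mem_commutativeCore a)
  tfae_have 3 → 1 := by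
    intro h
    rw [injective_iff_map_eq_zero]
    intro x hx
    by_contra hx0
    obtain ⟨a, b, u, r, hr, hab⟩ := LeavittPathAlgebra.reducesToVertex hE hx0
    -- The scalar stays inside the argument of `Φ`, so multiplicativity suffices.
    exact h u r hr (by rw [← hab, map_mul, map_mul, hx, mul_zero, zero_mul])
  tfae_finish
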